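/- **Setup.** Let $X\in\{0,1\}$ be a treatment, $Y$ an outcome in $\mathbb R$ and $W$ a covariate vector in $\mathbb R^{d}$. Let $P=F_{Y,X,W}$ be the law of $(Y,X,W)$, and fix a version of the conditional law of $(X,Y)$ given $W=w$. Write $p_{x|w}=\mathbb P(X=x\mid W=w)$ and $F_{Y|X,W}(y\mid x,w)=\mathbb P(Y\le y\mid X=x,W=w)$. Assume strict overlap: for some $\epsilon>0$, $p_{1|w}\in[\epsilon,1-\epsilon]$ for all $w\in\operatorname{supp}(W)$. Let $\underline c,\overline c$ be measurable functions (possibly depending on $P$) with $0<\underline c(w)\le p_{1|w}\le\overline c(w)<1$ for all $w\in\operatorname{supp}(W)$. For $w\in\operatorname{supp}(W)$ and $y\in\mathbb R$ put $$\underline F_{Y_1|W}(y|w)=\max\Big\{F_{Y|X,W}(y|1,w)\tfrac{p_{1|w}}{\overline c(w)},\ \tfrac{\underline c(w)-p_{1|w}}{\underline c(w)}+F_{Y|X,W}(y|1,w)\tfrac{p_{1|w}}{\underline c(w)}\Big\},$$ $$\overline F_{Y_1|W}(y|w)=\min\Big\{F_{Y|X,W}(y|1,w)\tfrac{p_{1|w}}{\underline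 c(w)},\ \tfrac{\overline c(w)-p_{1|w}}{\overline c(w)}+F_{Y|X,W}(y|1,w)\tfrac{p_{1|w}}{\overline c(w)}\Big\},$$ $$\underline F_{Y_0|W}(y|w)=\max\Big\{F_{Y|X,W}(y|0,w)\tfrac{p_{0|w}}{1-\underline c(w)},\ \tfrac{p_{1|w}-\overline c(w)}{1-\overline c(w)}+F_{Y|X,W}(y|0,w)\tfrac{p_{0|w}}{1-\overline c(w)}\Big\},$$ $$\overline F_{Y_0|W}(y|w)=\min\Big\{F_{Y|X,W}(y|0,w)\tfrac{p_{0|w}}{1-\overline c(w)},\ \tfrac{p_{1|w}-\underline c(w)}{1-\underline c(w)}+F_{Y|X,W}(y|0,w)\tfrac{p_{0|w}}{1-\underline c(w)}\Big\}.$$ **Identified sets.** Consider conditional laws (measurable in $(x,w)$) of potential outcomes $(Y_1,Y_0)$ given $(X,W)$ which are compatible with the observables, that is, $F_{Y_x|X,W}(\cdot\mid x,w)=F_{Y|X,W}(\cdot\mid x,w)$ for $x\in\{0,1\}$ and $w\in\operatorname{supp}(W)$. Together with $p_{x|w}$ such a law determines the law of $(Y_1,Y_0,X)$ given $W=w$.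 It satisfies *marginal $c$-dependence* if for all $w\in\operatorname{supp}(W)$ and $x\in\{0,1\}$, $\mathbb P(X=1\mid Y_x,W=w)\in[\underline c(w),\overline c(w)]$ almost surely given $W=w$, and *joint $c$-dependence* if for all $w\in\operatorname{supp}(W)$, $\mathbb P(X=1\mid Y_1,Y_0,W=w)\in[\underline c(w),\overline c(w)]$ almost surely given $W=w$. For $i\in\{\mathrm{marg},\mathrm{joint}\}$ let $\mathcal I^i$ be the set of triples $(F_{Y_1|X,W},F_{Y_0|X,W},C_{1,0|X,W})$ consisting of the conditional marginal cdfs of such a compatible law satisfying the corresponding form of $c$-dependence, and of copulas $C_{1,0|x,w}$ with $F_{Y_1,Y_0|X,W}(y_1,y_0|x,w)=C_{1,0|x,w}(F_{Y_1|X,W}(y_1|x,w),F_{Y_0|X,W}(y_0|x,w))$. Let $\mathcal I^i_0$ be the corresponding set of triples $(F_{Y_1|W},F_{Y_0|W},C_{1,0|X,W})$, where $F_{Y_x|W}(y|w)=\sum_{x'\in\{0,1\}}F_{Y_x|X,W}(y|x',w)\,p_{x'|w}$. **Parameter.** Fix $i\in\{\mathrm{marg},\mathrm{joint}\}$. Let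 $\theta(F_1,F_0,P)$ be a real-valued functional of families $F_1,F_0$ of conditional cdfs indexed by $w\in\operatorname{supp}(W)$, defined for $(F_1,F_0)\in D_1\times D_0$, where $F_1\in D_1$ and $F_0\in D_0$ for every $(F_1,F_0,C)\in\mathcal I_0^i$. Suppose that on $D_1\times D_0$ it is increasing in $F_1$ and decreasing in $F_0$, where $F$ is at least as large as $G$ if $F(\cdot|w)$ first-order stochastically dominates $G(\cdot|w)$, i.e. $F(y|w)\le G(y|w)$ for all $y$, for each $w\in\operatorname{supp}(W)$. Its identified set is $\mathcal I^i_\theta=\{\theta(F_1,F_0,P):(F_1,F_0,C)\in\mathcal I^i_0\text{ for some }C\}$. **Theorem.** The convex hull of $\mathcal I^i_\theta$ is the closed interval $$\Big[\inf_{(F_1,F_0,C)\in\mathcal I^i_0}\theta(F_1,F_0,P),\ \sup_{(F_1,F_0,C)\in\mathcal I^i_0}\theta(F_1,F_0,P)\Big]=\Big[\theta(\overline F_{Y_1|W},\underline F_{Y_0|W},P),\ \theta(\underline F_{Y_1|W},\overline F_{Y_0|W},P)\Big].$$ If moreover $(\varepsilon,\gamma)\mapsto\theta\big(\varepsilon\underline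 F_{Y_1|W}+(1-\varepsilon)\overline F_{Y_1|W},\ \gamma\underline F_{Y_0|W}+(1-\gamma)\overline F_{Y_0|W},\ P\big)$ is continuous on $[0,1]^2$, then $\mathcal I^i_\theta$ equals this interval. -/

import Mathlib

open MeasureTheory ProbabilityTheory Set

namespace CDependence

/-- Covariate space `ℝ^d`. -/
abbrev Cov (d : ℕ) : Type := Fin d → ℝ

/-- The support `supp(W)`, where `P` is the law of the observables `(W, X, Y)`.
The treatment is coded by `Bool`: `true` is `X = 1`, `false` is `X = 0`. -/
def suppW {d : ℕ} (P : Measure (Cov d × Bool × ℝ)) : Set (Cov d) :=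
  P.fst.support

/-- Families `F(y | w)`, `w ∈ supp(W)`, of functions of `y`: the type of `F_{Y_x | W}`. -/
abbrev CondFun {d : ℕ} (P : Measure (Cov d × Bool × ℝ)) : Type :=
  suppW P → ℝ → ℝ

/-- Families `F(y | x, w)`: the type of `F_{Y_x | X, W}`. -/
abbrev CondFunX {d : ℕ} (P : Measure (Cov d × Bool × ℝ)) : Type :=
  Bool → suppW P → ℝ → ℝ

/-- Families `C(u, v | x, w)`: the type of `C_{1,0 | X, W}` (only `u, v ∈ [0, 1]` matter). -/
abbrev CopulaFun {d : ℕ} (P : Measure (Cov d × Bool × ℝ)) : Type :=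
  Bool → suppW P → ℝ → ℝ → ℝ

/-- First-order stochastic dominance `F ⪰ G` of cdfs. -/
def FOSD (F G : ℝ → ℝ) : Prop := ∀ u, F u ≤ G u

/-- Bivariate copulas: grounded, uniform margins, 2-increasing on `[0, 1]²`. -/
structure IsCopula (C : ℝ → ℝ → ℝ) : Prop where
  grounded_left : ∀ v ∈ Icc (0 : ℝ) 1, C 0 v = 0
  grounded_right : ∀ u ∈ Icc (0 : ℝ) 1, C u 0 = 0
  margin_left : ∀ u ∈ Icc (0 : ℝ) 1, C u 1 = u
  margin_right : ∀ v ∈ Icc (0 : ℝ) 1, C 1 v = v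
  two_increasing : ∀ u ∈ Icc (0 : ℝ) 1, ∀ u' ∈ Icc (0 : ℝ) 1,
    ∀ v ∈ Icc (0 : ℝ) 1, ∀ v' ∈ Icc (0 : ℝ) 1, u ≤ u' → v ≤ v' →
      0 ≤ C u' v' - C u' v - C u v' + C u v

/-! In what follows `κ w` is the conditional law of `(X, Y)` given `W = w`. -/

section Observables

variable {d : ℕ} (κ : Kernel (Cov d) (Bool × ℝ))

/-- `p_{x|w} = P(X = x | W = w)`. -/
noncomputable def prop (x : Bool) (w : Cov d) : ℝ :=
  (κ w).real {o | o.1 = x}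

/-- `F_{Y | X, W}(y | x, w) = P(Y ≤ y | X = x, W = w)`. -/
noncomputable def obsCDF (x : Bool) (w : Cov d) (y : ℝ) : ℝ :=
  (ProbabilityTheory.cond (κ w) {o | o.1 = x}).real {o | o.2 ≤ y}

/-- Strict overlap. -/
def Overlap (P : Measure (Cov d × Bool × ℝ)) : Prop :=
  ∃ ε > 0, ∀ w ∈ suppW P, prop κ true w ∈ Icc ε (1 - ε)

/-- The requirement on the bound functions in (marginal or joint) `c`-dependence. -/
def AdmissibleBounds (P : Measure (Cov d × Bool × ℝ)) (cLo cHi : Cov d → ℝ) : Prop :=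
  ∀ w ∈ suppW P,
    0 < cLo w ∧ cLo w ≤ prop κ true w ∧ prop κ true w ≤ cHi w ∧ cHi w < 1

variable (P : Measure (Cov d × Bool × ℝ)) (cLo cHi : Cov d → ℝ)

/-- Lower cdf bound for `Y₁` given `W`. -/
noncomputable def lowerF1 : CondFun P := fun w y =>
  max (obsCDF κ true w y * (prop κ true w / cHi w))
    ((cLo w - prop κ true w) / cLo w + obsCDF κ true w y * (prop κ true w / cLo w))

/-- Upper cdf bound for `Y₁` given `W`. -/
noncomputable def upperF1 : CondFun P := fun w y =>
  min (obsCDF κ true w y * (prop κ true w / cLo w))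
    ((cHi w - prop κ true w) / cHi w + obsCDF κ true w y * (prop κ true w / cHi w))

/-- Lower cdf bound for `Y₀` given `W`. -/
noncomputable def lowerF0 : CondFun P := fun w y =>
  max (obsCDF κ false w y * (prop κ false w / (1 - cLo w)))
    ((prop κ true w - cHi w) / (1 - cHi w)
      + obsCDF κ false w y * (prop κ false w / (1 - cHi w)))

/-- Upper cdf bound for `Y₀` given `W`. -/
noncomputable def upperF0 : CondFun P := fun w y =>
  min (obsCDF κ false w y * (prop κ false w / (1 - cHi w)))
    ((prop κ true w - cLo w) / (1 - cLo w)
      + obsCDF κ false w y * (prop κ false w / (1 - cLo w)))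

end Observables

/-- The two versions of `c`-dependence. -/
inductive Model where
  | marg
  | joint

section Identified

variable {d : ℕ} (κ : Kernel (Cov d) (Bool × ℝ))

/-- The conditional law of `(X, (Y₁, Y₀))` given `W = w`, when `ν (x, w)` is the conditional law
of `(Y₁, Y₀)` given `X = x, W = w` and `X` has the observed law given `W = w`. -/
noncomputable def latentLaw (ν : Kernel (Bool × Cov d) (ℝ × ℝ)) (w : Cov d) :
    Measure (Bool × ℝ × ℝ) :=
  (κ w).fst ⊗ₘ (ν.sectL w)

/-- `P(X = 1 | T, W = w)` for a statistic `T` of `(X, (Y₁, Y₀))`. -/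
noncomputable def latentPropensity {α : Type} [mα : MeasurableSpace α]
    (ν : Kernel (Bool × Cov d) (ℝ × ℝ)) (w : Cov d) (T : Bool × ℝ × ℝ → α) :
    Bool × ℝ × ℝ → ℝ :=
  (latentLaw κ ν w)[({o | o.1 = true} : Set (Bool × ℝ × ℝ)).indicator (fun _ => (1 : ℝ)) |
    MeasurableSpace.comap T mα]

/-- The `c`-dependence restriction on the conditional law `ν` of `(Y₁, Y₀)` given `(X, W)`. -/
def SatisfiesCDep (P : Measure (Cov d × Bool × ℝ)) (cLo cHi : Cov d → ℝ)
    (ν : Kernel (Bool × Cov d) (ℝ × ℝ)) : Model → Prop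
  | .marg => ∀ w ∈ suppW P,
      (∀ᵐ o ∂(latentLaw κ ν w),
        latentPropensity κ ν w (fun o => o.2.1) o ∈ Icc (cLo w) (cHi w)) ∧
      (∀ᵐ o ∂(latentLaw κ ν w),
        latentPropensity κ ν w (fun o => o.2.2) o ∈ Icc (cLo w) (cHi w))
  | .joint => ∀ w ∈ suppW P,
      ∀ᵐ o ∂(latentLaw κ ν w),
        latentPropensity κ ν w (fun o => o.2) o ∈ Icc (cLo w) (cHi w)

/-- The identified set for `(F_{Y₁ | X, W}, F_{Y₀ | X, W}, C_{1,0 | X, W})`: the conditional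
marginal cdfs and copulas of some conditional law `ν` of `(Y₁, Y₀)` given `(X, W)` that is
compatible with the observed distribution and satisfies `c`-dependence. -/
def identifiedSet (P : Measure (Cov d × Bool × ℝ)) (cLo cHi : Cov d → ℝ) (i : Model) :
    Set (CondFunX P × CondFunX P × CopulaFun P) :=
  {t | ∃ ν : Kernel (Bool × Cov d) (ℝ × ℝ), IsMarkovKernel ν ∧
      (∀ x (w : suppW P) y, t.1 x w y = (ν (x, w)).real {z | z.1 ≤ y}) ∧
      (∀ x (w : suppW P) y, t.2.1 x w y = (ν (x, w)).real {z | z.2 ≤ y}) ∧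
      (∀ x (w : suppW P), IsCopula (t.2.2 x w)) ∧
      (∀ x (w : suppW P) y₁ y₀,
        (ν (x, w)).real {z | z.1 ≤ y₁ ∧ z.2 ≤ y₀}
          = t.2.2 x w (t.1 x w y₁) (t.2.1 x w y₀)) ∧
      (∀ (w : suppW P) y, t.1 true w y = obsCDF κ true w y) ∧
      (∀ (w : suppW P) y, t.2.1 false w y = obsCDF κ false w y) ∧
      SatisfiesCDep κ P cLo cHi ν i}

/-- `F_{Y_x | W}` from `F_{Y_x | X, W}`, by averaging over the treatment given `W = w`. -/
noncomputable def averageX (P : Measure (Cov d × Bool × ℝ)) (F : CondFunX P) : CondFun P :=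
  fun w y => F true w y * prop κ true w + F false w y * prop κ false w

/-- The identified set for `(F_{Y₁ | W}, F_{Y₀ | W}, C_{1,0 | X, W})`. -/
def identifiedSet₀ (P : Measure (Cov d × Bool × ℝ)) (cLo cHi : Cov d → ℝ) (i : Model) :
    Set (CondFun P × CondFun P × CopulaFun P) :=
  (fun t => (averageX κ P t.1, averageX κ P t.2.1, t.2.2)) '' identifiedSet κ P cLo cHi i

/-- The identified set of a parameter that is a functional of `(F_{Y₁ | X, W}, F_{Y₀ | X, W})`
and does not depend on the copula. -/
def paramIdentifiedSet (P : Measure (Cov d × Bool × ℝ)) (cLo cHi : Cov d → ℝ) (i : Model)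
    (θ : CondFunX P → CondFunX P → ℝ) : Set ℝ :=
  {r | ∃ F₁ F₀ C, (F₁, F₀, C) ∈ identifiedSet κ P cLo cHi i ∧ θ F₁ F₀ = r}

end Identified

/-- `θ` is increasing in its first argument over `D₁` and decreasing in its second argument over
`D₀`, families being compared by first-order stochastic dominance at every `w ∈ supp(W)`. -/
def IncreasingDecreasingOn {d : ℕ} {P : Measure (Cov d × Bool × ℝ)}
    (D₁ D₀ : Set (CondFun P)) (θ : CondFun P → CondFun P → ℝ) : Prop :=
  (∀ F₀ ∈ D₀, ∀ F ∈ D₁, ∀ G ∈ D₁, (∀ w, FOSD (F w) (G w)) → θ G F₀ ≤ θ F F₀) ∧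
  (∀ F₁ ∈ D₁, ∀ F ∈ D₀, ∀ G ∈ D₀, (∀ w, FOSD (F w) (G w)) → θ F₁ F ≤ θ F₁ G)

end CDependence

open CDependence

namespace CDependence

/-! Fix `w` and write `p`, `l`, `h` for the propensity and its two bounds. By
`condExp_indicator_mem_Icc_iff`, `c`-dependence is a family of linear inequalities between the
probabilities of events in the two treatment arms. Applied to `Y_x ≤ y` and to its complement, they
give exactly the four cdf bounds (`bounds_of_mem_identifiedSet₀`). Joint dependence implies marginal
dependence, so the bounds need proof only for the marginal model and their attainment only for the
joint one.

For attainment, let a latent binary state have `P(X = 1)` equal to `l` when low and `h` when high,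
with the weights that average to `p`. Given the state, take `X`, `Y₁`, `Y₀` independent. Then `P(X =
1 | Y₁, Y₀)` averages `l` and `h`, so joint dependence holds. It remains to split each observed law
between the states. Giving one state the upper tail and the other the lower tail attains one bound,
exchanging the tails attains the other, and mixing the two splits with weight `e` gives the convex
combinations (`tailMix_decomposition`, `tailMix_reweighted`). The splits for `Y₁` and `Y₀` are
chosen separately, so all pairs of weights occur (`exists_mem_identifiedSet₀_joint`).

All cdfs in the construction are distortions of the observed ones. The marginal distortions are
strictly increasing, so inverting them yields a copula even when the observed laws have atoms
(`exists_copula_of_mixture`).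

Monotonicity of `θ` then makes the two extreme pairs its minimum and maximum, which settles the
convex hull. Under continuity, the image of the unit square is connected and contains both
endpoints. -/

/-! ### Distortions of cdfs and the splitting of a law into tails -/

/-- Continuous increasing maps of the line that fix `0` and `1`. -/
structure IsDistortion (g : ℝ → ℝ) : Prop where
  continuous : Continuous g
  monotone : Monotone g
  map_zero : g 0 = 0
  map_one : g 1 = 1

lemma IsDistortion.mem_Icc {g : ℝ → ℝ} (hg : IsDistortion g) {u : ℝ} (hu : u ∈ Icc (0 : ℝ) 1) :
    g u ∈ Icc (0 : ℝ) 1 :=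
  ⟨hg.map_zero ▸ hg.monotone hu.1, hg.map_one ▸ hg.monotone hu.2⟩

lemma IsDistortion.mix {g h : ℝ → ℝ} (hg : IsDistortion g) (hh : IsDistortion h) {e : ℝ}
    (he : e ∈ Icc (0 : ℝ) 1) : IsDistortion fun u => e * g u + (1 - e) * h u where
  continuous := by have := hg.continuous; have := hh.continuous; fun_prop
  monotone u v huv := add_le_add (mul_le_mul_of_nonneg_left (hg.monotone huv) he.1)
    (mul_le_mul_of_nonneg_left (hh.monotone huv) (sub_nonneg.2 he.2))
  map_zero := by simp [hg.map_zero, hh.map_zero]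
  map_one := by simp [hg.map_one, hh.map_one]

lemma IsDistortion.reflect {g : ℝ → ℝ} (hg : IsDistortion g) :
    IsDistortion fun u => 1 - g (1 - u) where
  continuous := by have := hg.continuous; fun_prop
  monotone u v huv := sub_le_sub_left (hg.monotone (sub_le_sub_left huv 1)) 1
  map_zero := by simp [hg.map_one]
  map_one := by simp [hg.map_zero]

/-- The cdf transform that conditions a law on its lower part of mass `l`. -/
noncomputable def lowPart (l u : ℝ) : ℝ := if l = 0 then u else min (u / l) 1

lemma isDistortion_lowPart {l : ℝ} (hl : l ∈ Icc (0 : ℝ) 1) : IsDistortion (lowPart l) := by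
  unfold lowPart
  by_cases h : l = 0
  · simp only [h, if_true]
    exact ⟨continuous_id, monotone_id, rfl, rfl⟩
  · have hp : 0 < l := lt_of_le_of_ne hl.1 (Ne.symm h)
    simp only [h, if_false]
    refine ⟨by fun_prop, fun u v huv => min_le_min_right _ (by gcongr), by simp, ?_⟩
    exact min_eq_right ((one_le_div hp).2 hl.2)

/-- Multiplying by the mass removes the division and makes the convention at `l = 0` harmless. -/
lemma mul_lowPart {l u : ℝ} (hl : 0 ≤ l) (hu : 0 ≤ u) : l * lowPart l u = min u l := by
  unfold lowPart
  by_cases h : l = 0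
  · simp [h, hu]
  · rw [if_neg h, mul_min_of_nonneg _ _ hl, mul_div_cancel₀ _ h, mul_one]

lemma measurable_lowPart : Measurable fun q : ℝ × ℝ => lowPart q.1 q.2 :=
  Measurable.ite (measurable_fst (measurableSet_singleton (0 : ℝ))) measurable_snd (by fun_prop)

/-- The cdf transform that mixes the upper part of mass `l` of a law, with weight `e`, and its
lower part of mass `l`. -/
noncomputable def tailMix (l e u : ℝ) : ℝ := e * (1 - lowPart l (1 - u)) + (1 - e) * lowPart l u

lemma isDistortion_tailMix {l e : ℝ} (hl : l ∈ Icc (0 : ℝ) 1) (he : e ∈ Icc (0 : ℝ) 1) :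
    IsDistortion (tailMix l e) :=
  (isDistortion_lowPart hl).reflect.mix (isDistortion_lowPart hl) he

lemma measurable_tailMix (e : ℝ) : Measurable fun q : ℝ × ℝ => tailMix q.1 e q.2 := by
  have h1 : Measurable fun q : ℝ × ℝ => lowPart q.1 (1 - q.2) :=
    measurable_lowPart.comp (measurable_fst.prodMk (measurable_snd.const_sub 1))
  have h2 := measurable_lowPart
  unfold tailMix
  fun_prop

lemma mul_tailMix {l e u : ℝ} (hl : 0 ≤ l) (hu : u ∈ Icc (0 : ℝ) 1) :
    l * tailMix l e u = e * (l - min (1 - u) l) + (1 - e) * min u l := by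
  rw [← mul_lowPart hl hu.1, ← mul_lowPart hl (sub_nonneg.2 hu.2), tailMix]
  ring

/-- The upper part of mass `l` and the lower part of mass `1 - l` are complementary, as are the
opposite pair; hence the weight `1 - e` in the second term. -/
lemma tailMix_decomposition {l e u : ℝ} (hl : l ∈ Icc (0 : ℝ) 1) (hu : u ∈ Icc (0 : ℝ) 1) :
    l * tailMix l e u + (1 - l) * tailMix (1 - l) (1 - e) u = u := by
  rw [mul_tailMix hl.1 hu, mul_tailMix (sub_nonneg.2 hl.2) hu]
  rcases le_total u l with h | h <;> rcases le_total (1 - u) l with h' | h' <;>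
    simp only [min_eq_left, min_eq_right, h, h', show u ≤ 1 - l ↔ l ≤ 1 - u from
      ⟨fun _ => by linarith, fun _ => by linarith⟩, show 1 - l ≤ u ↔ 1 - u ≤ l from
      ⟨fun _ => by linarith, fun _ => by linarith⟩, show 1 - u ≤ 1 - l ↔ l ≤ u from
      ⟨fun _ => by linarith, fun _ => by linarith⟩, show 1 - l ≤ 1 - u ↔ u ≤ l from
      ⟨fun _ => by linarith, fun _ => by linarith⟩] <;> ring

/-- The law is reweighted by the larger density `A` on a part of mass `l` and by `B` on the rest.
With `A` on the upper part the resulting cdf transform has slope `B`, then `A`, so it is convex and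
is a maximum of two lines; with `A` on the lower part it is concave and is a minimum. -/
lemma tailMix_reweighted {l e u A B : ℝ} (hl : l ∈ Icc (0 : ℝ) 1) (hu : u ∈ Icc (0 : ℝ) 1)
    (hAB : B ≤ A) (h : l * A + (1 - l) * B = 1) :
    A * (l * tailMix l e u) + B * ((1 - l) * tailMix (1 - l) (1 - e) u)
      = e * max (u * B) ((1 - A) + u * A) + (1 - e) * min (u * A) ((1 - B) + u * B) := by
  rw [mul_tailMix hl.1 hu, mul_tailMix (sub_nonneg.2 hl.2) hu]
  have h1 : max (u * B) ((1 - A) + u * A)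
      = A * (l - min (1 - u) l) + B * min u (1 - l) := by
    rcases le_total u (1 - l) with h' | h'
    · rw [min_eq_right (by linarith : l ≤ 1 - u), min_eq_left h', max_eq_left (by nlinarith)]
      ring
    · rw [min_eq_left (by linarith : 1 - u ≤ l), min_eq_right h', max_eq_right (by nlinarith)]
      linear_combination -h
  have h2 : min (u * A) ((1 - B) + u * B)
      = A * min u l + B * ((1 - l) - min (1 - u) (1 - l)) := by
    rcases le_total u l with h' | h'
    · rw [min_eq_right (by linarith : 1 - l ≤ 1 - u), min_eq_left h', min_eq_left (by nlinarith)]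
      ring
    · rw [min_eq_left (by linarith : 1 - u ≤ 1 - l), min_eq_right h', min_eq_right (by nlinarith)]
      linear_combination -h
  rw [h1, h2]
  ring

/-- Reweighting a decomposition of the identity by positive factors keeps it strictly
increasing. -/
lemma strictMonoOn_reweighted {b b' : ℝ → ℝ} (hb : Monotone b) (hb' : Monotone b')
    {l m s t : ℝ} (hm : m ∈ Icc (0 : ℝ) 1)
    (hid : ∀ u ∈ Icc (0 : ℝ) 1, m * b u + (1 - m) * b' u = u) (hs : 0 < s) (ht : 0 < t)
    (hl : l = s * m) (hl' : 1 - l = t * (1 - m)) :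
    StrictMonoOn (fun u => l * b u + (1 - l) * b' u) (Icc 0 1) := by
  intro u hu v hv huv
  simp only [hl']
  simp only [hl]
  have h1 := mul_le_mul_of_nonneg_left (hb huv.le) hm.1
  have h2 := mul_le_mul_of_nonneg_left (hb' huv.le) (sub_nonneg.2 hm.2)
  have hu' := hid u hu
  have hv' := hid v hv
  have h3 := mul_le_mul_of_nonneg_left h1 hs.le
  have h4 := mul_le_mul_of_nonneg_left h2 ht.le
  -- The two increments sum to `v - u > 0`, so at least one is positive, and it stays so after
  -- multiplication by `s` or `t`.
  by_cases h : m * b u < m * b v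
  · have := mul_lt_mul_of_pos_left h hs
    linarith
  · have : (1 - m) * b' u < (1 - m) * b' v := by linarith
    have := mul_lt_mul_of_pos_left this ht
    linarith

/-! ### Inverse distortions and copulas -/

lemma IsDistortion.exists_inverse {K : ℝ → ℝ} (hK : IsDistortion K)
    (hs : StrictMonoOn K (Icc 0 1)) :
    ∃ r : ℝ → ℝ, (∀ v ∈ Icc (0 : ℝ) 1, r v ∈ Icc (0 : ℝ) 1 ∧ K (r v) = v) ∧
      (∀ u ∈ Icc (0 : ℝ) 1, r (K u) = u) ∧ MonotoneOn r (Icc 0 1) ∧ r 0 = 0 ∧ r 1 = 1 := by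
  have h : ∀ v, ∃ u, v ∈ Icc (0 : ℝ) 1 → u ∈ Icc (0 : ℝ) 1 ∧ K u = v := by
    intro v
    by_cases hv : v ∈ Icc (0 : ℝ) 1
    · have := intermediate_value_Icc zero_le_one hK.continuous.continuousOn
      rw [hK.map_zero, hK.map_one] at this
      obtain ⟨u, hu, huv⟩ := this hv
      exact ⟨u, fun _ => ⟨hu, huv⟩⟩
    · exact ⟨0, fun h => absurd h hv⟩
  choose r hr using h
  have hinv : ∀ u ∈ Icc (0 : ℝ) 1, r (K u) = u := fun u hu =>
    hs.injOn (hr _ (hK.mem_Icc hu)).1 hu (hr _ (hK.mem_Icc hu)).2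
  refine ⟨r, hr, hinv, ?_, ?_, ?_⟩
  · intro v hv v' hv' hvv
    exact (hs.le_iff_le (hr v hv).1 (hr v' hv').1).1 (by rwa [(hr v hv).2, (hr v' hv').2])
  · have := hinv 0 (by simp)
    rwa [hK.map_zero] at this
  · have := hinv 1 (by simp)
    rwa [hK.map_one] at this

/-- The joint cdf of a two-component mixture of independent pairs comes from a copula. -/
lemma exists_copula_of_mixture {a a' b b' : ℝ → ℝ} (ha : IsDistortion a) (ha' : IsDistortion a')
    (hb : IsDistortion b) (hb' : IsDistortion b') {l : ℝ} (hl : l ∈ Icc (0 : ℝ) 1)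
    (hK : StrictMonoOn (fun u => l * a u + (1 - l) * a' u) (Icc 0 1))
    (hL : StrictMonoOn (fun u => l * b u + (1 - l) * b' u) (Icc 0 1)) :
    ∃ C : ℝ → ℝ → ℝ, IsCopula C ∧ ∀ u ∈ Icc (0 : ℝ) 1, ∀ v ∈ Icc (0 : ℝ) 1,
      C (l * a u + (1 - l) * a' u) (l * b v + (1 - l) * b' v)
        = l * (a u * b v) + (1 - l) * (a' u * b' v) := by
  obtain ⟨r, hr, hrK, hrm, hr0, hr1⟩ := (ha.mix ha' hl).exists_inverse hK
  obtain ⟨q, hq, hqL, hqm, hq0, hq1⟩ := (hb.mix hb' hl).exists_inverse hL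
  -- The joint cdf pulled back along the inverses of its margins; each summand is a product of
  -- increasing functions, hence 2-increasing.
  refine ⟨fun u v => l * (a (r u) * b (q v)) + (1 - l) * (a' (r u) * b' (q v)), ?_, ?_⟩
  · constructor
    · intro v _
      simp [hr0, ha.map_zero, ha'.map_zero]
    · intro u _
      simp [hq0, hb.map_zero, hb'.map_zero]
    · intro u hu
      simpa [hq1, hb.map_one, hb'.map_one] using (hr u hu).2
    · intro v hv
      simpa [hr1, ha.map_one, ha'.map_one] using (hq v hv).2
    · intro u hu u' hu' v hv v' hv' huu hvv
      have h1 := mul_nonneg (sub_nonneg.2 (ha.monotone (hrm hu hu' huu)))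
        (sub_nonneg.2 (hb.monotone (hqm hv hv' hvv)))
      have h2 := mul_nonneg (sub_nonneg.2 (ha'.monotone (hrm hu hu' huu)))
        (sub_nonneg.2 (hb'.monotone (hqm hv hv' hvv)))
      have := add_nonneg (mul_nonneg hl.1 h1) (mul_nonneg (sub_nonneg.2 hl.2) h2)
      linarith
  · intro u hu v hv
    simp only [hrK u hu, hqL v hv]

/-! ### `c`-dependence as inequalities on events -/

section

/-- A conditional probability lies in `[l, h]` almost surely iff the corresponding inequalities
hold on every event of the conditioning σ-algebra. -/
lemma condExp_indicator_mem_Icc_iff {Ω α : Type*} [mΩ : MeasurableSpace Ω]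
    [mα : MeasurableSpace α] (ρ : Measure Ω) [IsFiniteMeasure ρ] {T : Ω → α} (hT : Measurable T)
    {E : Set Ω} (hE : MeasurableSet E) (l h : ℝ) :
    (∀ᵐ o ∂ρ, (ρ[E.indicator (fun _ => (1 : ℝ)) | MeasurableSpace.comap T mα]) o ∈ Icc l h) ↔
      ∀ A, MeasurableSet A → l * ρ.real (T ⁻¹' A) ≤ ρ.real (E ∩ T ⁻¹' A) ∧
        ρ.real (E ∩ T ⁻¹' A) ≤ h * ρ.real (T ⁻¹' A) := by
  have hm : MeasurableSpace.comap T mα ≤ mΩ := hT.comap_le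
  set f : Ω → ℝ := ρ[E.indicator (fun _ => (1 : ℝ)) | MeasurableSpace.comap T mα] with hf
  have hint : Integrable (E.indicator (fun _ => (1 : ℝ))) ρ :=
    (integrable_const (1 : ℝ)).indicator hE
  have hfi : Integrable f ρ := integrable_condExp
  have hfm : StronglyMeasurable[MeasurableSpace.comap T mα] f := stronglyMeasurable_condExp
  have hset : ∀ A, MeasurableSet A → ∫ o in T ⁻¹' A, f o ∂ρ = ρ.real (E ∩ T ⁻¹' A) := by
    intro A hA
    rw [hf, setIntegral_condExp hm hint ⟨A, hA, rfl⟩, integral_indicator_const _ hE]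
    simp [measureReal_def, Measure.restrict_apply hE]
  have hconst : ∀ (c : ℝ) (A : Set α), ∫ _ in T ⁻¹' A, c ∂ρ = c * ρ.real (T ⁻¹' A) := by
    intro c A
    simp [mul_comm]
  constructor
  · intro hae A hA
    rw [← hset A hA, ← hconst l A, ← hconst h A]
    exact ⟨integral_mono_ae (integrable_const _).integrableOn hfi.integrableOn
        (ae_restrict_of_ae (hae.mono fun o ho => ho.1)),
      integral_mono_ae hfi.integrableOn (integrable_const _).integrableOn
        (ae_restrict_of_ae (hae.mono fun o ho => ho.2))⟩
  · intro hA
    have h1 : (fun _ => l) ≤ᵐ[ρ] f := by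
      -- On the trimmed measure, only events of the conditioning σ-algebra have to be tested.
      refine ae_le_of_ae_le_trim (hm := hm) ?_
      refine ae_le_of_forall_setIntegral_le (integrable_const l) (hfi.trim hm hfm) ?_
      rintro s hs -
      rw [← setIntegral_trim hm stronglyMeasurable_const hs, ← setIntegral_trim hm hfm hs]
      obtain ⟨A, hAm, rfl⟩ := hs
      rw [hconst, hset A hAm]
      exact (hA A hAm).1
    have h2 : f ≤ᵐ[ρ] (fun _ => h) := by
      refine ae_le_of_ae_le_trim (hm := hm) ?_
      refine ae_le_of_forall_setIntegral_le (hfi.trim hm hfm) (integrable_const h) ?_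
      rintro s hs -
      rw [← setIntegral_trim hm stronglyMeasurable_const hs, ← setIntegral_trim hm hfm hs]
      obtain ⟨A, hAm, rfl⟩ := hs
      rw [hconst, hset A hAm]
      exact (hA A hAm).2
    filter_upwards [h1, h2] with o ho1 ho2 using ⟨ho1, ho2⟩

variable {d : ℕ} (κ : Kernel (Cov d) (Bool × ℝ)) [IsMarkovKernel κ]

lemma prop_true_add_prop_false (w : Cov d) : prop κ true w + prop κ false w = 1 := by
  have h : MeasurableSet {o : Bool × ℝ | o.1 = true} := measurable_fst (measurableSet_singleton _)
  have := probReal_add_probReal_compl (μ := κ w) h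
  have e : {o : Bool × ℝ | o.1 = true}ᶜ = {o | o.1 = false} := by ext; simp
  rwa [e] at this

lemma latentLaw_real (ν : Kernel (Bool × Cov d) (ℝ × ℝ)) [IsMarkovKernel ν] (w : Cov d)
    {S : Set (Bool × ℝ × ℝ)} (hS : MeasurableSet S) :
    (latentLaw κ ν w).real S = prop κ true w * (ν (true, w)).real (Prod.mk true ⁻¹' S)
      + prop κ false w * (ν (false, w)).real (Prod.mk false ⁻¹' S) := by
  have h : ∀ x, ((κ w).fst {x}).toReal = prop κ x w := by
    intro x
    rw [Measure.fst_apply (measurableSet_singleton x)]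
    rfl
  rw [measureReal_def, latentLaw, Measure.compProd_apply hS, lintegral_fintype, Fintype.sum_bool,
    ENNReal.toReal_add (by finiteness) (by finiteness), ENNReal.toReal_mul, ENNReal.toReal_mul,
    h, h]
  simp only [Kernel.sectL_apply, measureReal_def]
  ring

/-- `c`-dependence on a statistic of `(Y₁, Y₀)` in terms of the two conditional laws given the
treatment. -/
lemma latentPropensity_mem_Icc_iff {α : Type} [MeasurableSpace α]
    (ν : Kernel (Bool × Cov d) (ℝ × ℝ)) [IsMarkovKernel ν] (w : Cov d) {T : ℝ × ℝ → α}
    (hT : Measurable T) (l h : ℝ) :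
    (∀ᵐ o ∂(latentLaw κ ν w), latentPropensity κ ν w (fun o => T o.2) o ∈ Icc l h) ↔
      ∀ A, MeasurableSet A →
        prop κ true w * (ν (true, w)).real (T ⁻¹' A) ∈
          Icc (l * (prop κ true w * (ν (true, w)).real (T ⁻¹' A)
              + prop κ false w * (ν (false, w)).real (T ⁻¹' A)))
            (h * (prop κ true w * (ν (true, w)).real (T ⁻¹' A)
              + prop κ false w * (ν (false, w)).real (T ⁻¹' A))) := by
  have hE : MeasurableSet {o : Bool × ℝ × ℝ | o.1 = true} :=
    measurable_fst (measurableSet_singleton _)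
  have : IsFiniteMeasure (latentLaw κ ν w) := by unfold latentLaw; infer_instance
  have hT' : Measurable fun o : Bool × ℝ × ℝ => T o.2 := hT.comp measurable_snd
  unfold latentPropensity
  rw [condExp_indicator_mem_Icc_iff (latentLaw κ ν w) hT' hE l h]
  refine forall₂_congr fun A hA => ?_
  rw [latentLaw_real κ ν w (hT' hA), latentLaw_real κ ν w (hE.inter (hT' hA))]
  have e1 : Prod.mk true ⁻¹' ({o : Bool × ℝ × ℝ | o.1 = true} ∩ (fun o => T o.2) ⁻¹' A)
      = T ⁻¹' A := by ext; simp
  have e2 : Prod.mk false ⁻¹' ({o : Bool × ℝ × ℝ | o.1 = true} ∩ (fun o => T o.2) ⁻¹' A)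
      = ∅ := by ext; simp
  have e3 : ∀ x : Bool, Prod.mk x ⁻¹' ((fun o : Bool × ℝ × ℝ => T o.2) ⁻¹' A) = T ⁻¹' A := by
    intro x; ext; simp
  rw [e1, e2, e3, e3, measureReal_empty, mul_zero, add_zero]
  rfl

/-- An event of one coordinate is an event of the pair, so the joint inequalities include the
marginal ones. -/
lemma satisfiesCDep_marg_of_joint (P : Measure (Cov d × Bool × ℝ)) (cLo cHi : Cov d → ℝ)
    (ν : Kernel (Bool × Cov d) (ℝ × ℝ)) [IsMarkovKernel ν]
    (h : SatisfiesCDep κ P cLo cHi ν .joint) : SatisfiesCDep κ P cLo cHi ν .marg := by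
  simp only [SatisfiesCDep] at h ⊢
  intro w hw
  have h' := (latentPropensity_mem_Icc_iff κ ν w (T := fun z => z) measurable_id (cLo w)
    (cHi w)).1 (h w hw)
  exact ⟨(latentPropensity_mem_Icc_iff κ ν w (T := fun z => z.1) measurable_fst _ _).2
      fun A hA => h' (Prod.fst ⁻¹' A) (measurable_fst hA),
    (latentPropensity_mem_Icc_iff κ ν w (T := fun z => z.2) measurable_snd _ _).2
      fun A hA => h' (Prod.snd ⁻¹' A) (measurable_snd hA)⟩

end

/-! ### Kernels with prescribed cdfs -/

section

lemma real_Iic_mem_Icc (μ : Measure ℝ) [IsProbabilityMeasure μ] (y : ℝ) :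
    μ.real (Iic y) ∈ Icc (0 : ℝ) 1 := ⟨measureReal_nonneg, measureReal_le_one⟩

/-- Continuity of the distortion preserves right continuity, and fixing `0` and `1` preserves the
limits, so the distorted cdf is again a cdf. -/
lemma exists_distorted_kernel {α : Type*} [MeasurableSpace α] (M : Kernel α ℝ)
    [IsMarkovKernel M] {g : α → ℝ → ℝ} (hg : ∀ a, IsDistortion (g a))
    (hgm : Measurable fun q : α × ℝ => g q.1 q.2) :
    ∃ N : Kernel α ℝ, IsMarkovKernel N ∧
      ∀ a y, (N a).real (Iic y) = g a ((M a).real (Iic y)) := by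
  let S : α → StieltjesFunction ℝ := fun a =>
    { toFun := fun y => g a (cdf (M a) y)
      mono' := (hg a).monotone.comp (monotone_cdf _)
      right_continuous' := fun x =>
        (hg a).continuous.continuousAt.comp_continuousWithinAt ((cdf (M a)).right_continuous x) }
  have hS : ∀ a y, S a y = g a ((M a).real (Iic y)) := fun a y => by
    rw [← cdf_eq_real]
  have hbot : ∀ a, Filter.Tendsto (S a) Filter.atBot (nhds 0) := fun a => by
    have := ((hg a).continuous.tendsto 0).comp (tendsto_cdf_atBot (M a))
    rwa [(hg a).map_zero] at this
  have htop : ∀ a, Filter.Tendsto (S a) Filter.atTop (nhds 1) := fun a => by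
    have := ((hg a).continuous.tendsto 1).comp (tendsto_cdf_atTop (M a))
    rwa [(hg a).map_one] at this
  have hmeas : ∀ y, Measurable fun a => S a y := fun y => by
    simp only [hS]
    exact hgm.comp (measurable_id.prodMk
      (Kernel.measurable_coe M measurableSet_Iic).ennreal_toReal)
  refine ⟨⟨fun a => (S a).measure, StieltjesFunction.measurable_measure hmeas hbot htop⟩,
    ⟨fun a => (S a).isProbabilityMeasure (hbot a) (htop a)⟩, fun a y => ?_⟩
  have hnn : 0 ≤ g a ((M a).real (Iic y)) := ((hg a).mem_Icc (real_Iic_mem_Icc _ _)).1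
  change ((S a).measure (Iic y)).toReal = _
  rw [(S a).measure_Iic (hbot a), sub_zero, hS, ENNReal.toReal_ofReal hnn]

lemma exists_mixture_kernel {α β : Type*} [MeasurableSpace α] [MeasurableSpace β]
    (M N : Kernel α β) [IsMarkovKernel M] [IsMarkovKernel N] {l : α → ℝ} (hlm : Measurable l)
    (hl : ∀ a, l a ∈ Icc (0 : ℝ) 1) :
    ∃ K : Kernel α β, IsMarkovKernel K ∧
      ∀ a S, (K a).real S = l a * (M a).real S + (1 - l a) * (N a).real S := by
  refine ⟨⟨fun a => ENNReal.ofReal (l a) • M a + ENNReal.ofReal (1 - l a) • N a, ?_⟩, ⟨?_⟩, ?_⟩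
  · refine Measure.measurable_of_measurable_coe _ fun S hS => ?_
    simp only [Measure.coe_add, Measure.coe_smul, Pi.add_apply, Pi.smul_apply, smul_eq_mul]
    exact (hlm.ennreal_ofReal.mul (Kernel.measurable_coe M hS)).add
      ((hlm.const_sub 1).ennreal_ofReal.mul (Kernel.measurable_coe N hS))
  · intro a
    constructor
    change (ENNReal.ofReal (l a) • M a + ENNReal.ofReal (1 - l a) • N a) univ = 1
    simp only [Measure.coe_add, Measure.coe_smul, Pi.add_apply, Pi.smul_apply, smul_eq_mul,
      measure_univ, mul_one]
    rw [← ENNReal.ofReal_add (hl a).1 (sub_nonneg.2 (hl a).2)]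
    simp
  · intro a S
    change ((ENNReal.ofReal (l a) • M a + ENNReal.ofReal (1 - l a) • N a) S).toReal = _
    simp only [Measure.coe_add, Measure.coe_smul, Pi.add_apply, Pi.smul_apply, smul_eq_mul]
    rw [ENNReal.toReal_add (by finiteness) (by finiteness), ENNReal.toReal_mul,
      ENNReal.toReal_mul, ENNReal.toReal_ofReal (hl a).1,
      ENNReal.toReal_ofReal (sub_nonneg.2 (hl a).2)]
    rfl

lemma measurable_prop {d : ℕ} (κ : Kernel (Cov d) (Bool × ℝ)) (x : Bool) :
    Measurable (prop κ x) :=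
  (Kernel.measurable_coe κ (measurable_fst (measurableSet_singleton x))).ennreal_toReal

variable {d : ℕ} (κ : Kernel (Cov d) (Bool × ℝ)) [IsMarkovKernel κ]

/-- A version of the conditional law of `Y` given `X = x` and `W`. -/
lemma exists_obsKernel (x : Bool) :
    ∃ M : Kernel (Cov d) ℝ, IsMarkovKernel M ∧
      ∀ w, prop κ x w ≠ 0 → ∀ y, (M w).real (Iic y) = obsCDF κ x w y := by
  classical
  have hx : MeasurableSet {o : Bool × ℝ | o.1 = x} := measurable_fst (measurableSet_singleton x)
  let U : Set (Cov d) := {w | κ w {o | o.1 = x} = 0}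
  have hU : MeasurableSet U := Kernel.measurable_coe κ hx (measurableSet_singleton 0)
  -- Where arm `x` has probability zero, `cond` is the zero measure; a Dirac mass replaces it to
  -- keep the kernel Markov.
  have hm : Measurable fun w =>
      if w ∈ U then Measure.dirac (0 : ℝ) else (cond (κ w) {o | o.1 = x}).map Prod.snd := by
    refine Measurable.ite hU measurable_const ?_
    refine Measure.measurable_of_measurable_coe _ fun S hS => ?_
    simp only [Measure.map_apply measurable_snd hS, cond_apply hx]
    exact (Kernel.measurable_coe κ hx).inv.mul
      (Kernel.measurable_coe κ (hx.inter (measurable_snd hS)))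
  refine ⟨⟨_, hm⟩, ⟨fun w => ?_⟩, fun w hw y => ?_⟩
  · change IsProbabilityMeasure (if w ∈ U then _ else _)
    split_ifs with h
    · infer_instance
    · have := cond_isProbabilityMeasure (μ := κ w) h
      exact Measure.isProbabilityMeasure_map measurable_snd.aemeasurable
  · have h : w ∉ U := fun h => hw (by
      simp only [prop, measureReal_def]
      rw [show κ w {o | o.1 = x} = 0 from h]; rfl)
    change (if w ∈ U then _ else _ : Measure ℝ).real (Iic y) = _
    rw [if_neg h, measureReal_def, Measure.map_apply measurable_snd measurableSet_Iic]
    rfl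

end

/-! ### Validity of the cdf bounds -/

section

/-- The event `Y ≤ y` gives the terms without a constant, its complement those with one. -/
lemma cdf_bounds_of_propensity_bounds {p l h F G : ℝ} (hl : 0 < l) (hh : 0 < h)
    (h1 : p * F ∈ Icc (l * G) (h * G)) (h2 : p * (1 - F) ∈ Icc (l * (1 - G)) (h * (1 - G))) :
    max (F * (p / h)) ((l - p) / l + F * (p / l)) ≤ G ∧
      G ≤ min (F * (p / l)) ((h - p) / h + F * (p / h)) := by
  obtain ⟨a1, a2⟩ := h1
  obtain ⟨b1, b2⟩ := h2
  have e1 : F * (p / h) = p * F / h := by ring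
  have e2 : F * (p / l) = p * F / l := by ring
  have e3 : (l - p) / l + F * (p / l) = (l - p * (1 - F)) / l := by ring
  have e4 : (h - p) / h + F * (p / h) = (h - p * (1 - F)) / h := by ring
  rw [e3, e4, e1, e2]
  refine ⟨max_le ?_ ?_, le_min ?_ ?_⟩
  · rw [div_le_iff₀ hh]; linarith
  · rw [div_le_iff₀ hl]; linarith
  · rw [le_div_iff₀ hl]; linarith
  · rw [le_div_iff₀ hh]; linarith

variable {d : ℕ} {κ : Kernel (Cov d) (Bool × ℝ)} [IsMarkovKernel κ]
  {P : Measure (Cov d × Bool × ℝ)} {cLo cHi : Cov d → ℝ}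

lemma bounds_of_mem_identifiedSet₀ (hc : AdmissibleBounds κ P cLo cHi) {i : Model}
    {t : CondFun P × CondFun P × CopulaFun P} (ht : t ∈ identifiedSet₀ κ P cLo cHi i) :
    ∀ w y, (lowerF1 κ P cLo cHi w y ≤ t.1 w y ∧ t.1 w y ≤ upperF1 κ P cLo cHi w y) ∧
      lowerF0 κ P cLo cHi w y ≤ t.2.1 w y ∧ t.2.1 w y ≤ upperF0 κ P cLo cHi w y := by
  obtain ⟨T, ⟨ν, hν, h1, h0, -, -, hobs1, hobs0, hdep⟩, rfl⟩ := ht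
  intro w y
  have hmarg : SatisfiesCDep κ P cLo cHi ν .marg := by
    cases i
    · exact hdep
    · exact satisfiesCDep_marg_of_joint κ P cLo cHi ν hdep
  simp only [SatisfiesCDep] at hmarg
  obtain ⟨hl, hlp, hph, hh⟩ := hc w w.2
  obtain ⟨hd1, hd0⟩ := hmarg w w.2
  have hq := prop_true_add_prop_false κ (w : Cov d)
  have k1 := (latentPropensity_mem_Icc_iff κ ν (w : Cov d) (T := fun z => z.1) measurable_fst
    _ _).1 hd1
  have k0 := (latentPropensity_mem_Icc_iff κ ν (w : Cov d) (T := fun z => z.2) measurable_snd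
    _ _).1 hd0
  have c1 : ∀ x, (ν (x, (w : Cov d))).real ((fun z : ℝ × ℝ => z.1) ⁻¹' (Iic y)ᶜ)
      = 1 - T.1 x w y := fun x => by
    rw [preimage_compl, probReal_compl_eq_one_sub (measurable_fst measurableSet_Iic), h1]; rfl
  have c0 : ∀ x, (ν (x, (w : Cov d))).real ((fun z : ℝ × ℝ => z.2) ⁻¹' (Iic y)ᶜ)
      = 1 - T.2.1 x w y := fun x => by
    rw [preimage_compl, probReal_compl_eq_one_sub (measurable_snd measurableSet_Iic), h0]; rfl
  have d1 : ∀ x, (ν (x, (w : Cov d))).real ((fun z : ℝ × ℝ => z.1) ⁻¹' (Iic y))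
      = T.1 x w y := fun x => (h1 x w y).symm
  have d0 : ∀ x, (ν (x, (w : Cov d))).real ((fun z : ℝ × ℝ => z.2) ⁻¹' (Iic y))
      = T.2.1 x w y := fun x => (h0 x w y).symm
  have a1 := k1 _ (measurableSet_Iic (a := y))
  have b1 := k1 _ (measurableSet_Iic (a := y)).compl
  have a0 := k0 _ (measurableSet_Iic (a := y))
  have b0 := k0 _ (measurableSet_Iic (a := y)).compl
  rw [c1, c1, hobs1] at b1
  rw [d1, d1, hobs1] at a1
  rw [c0, c0, hobs0] at b0
  rw [d0, d0, hobs0] at a0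
  simp only [averageX, lowerF1, upperF1, lowerF0, upperF0, hobs1, hobs0]
  generalize obsCDF κ true w y = F₁ at *
  generalize obsCDF κ false w y = F₀ at *
  generalize T.1 false w y = G₁ at *
  generalize T.2.1 true w y = G₀ at *
  have hqe : prop κ false (w : Cov d) = 1 - prop κ true (w : Cov d) := by linarith
  rw [hqe] at a1 b1 a0 b0 ⊢
  generalize prop κ true (w : Cov d) = p at *
  generalize cLo w = l at *
  generalize cHi w = h at *
  obtain ⟨a1l, a1h⟩ := a1
  obtain ⟨b1l, b1h⟩ := b1
  obtain ⟨a0l, a0h⟩ := a0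
  obtain ⟨b0l, b0h⟩ := b0
  constructor
  · exact cdf_bounds_of_propensity_bounds hl (by linarith) ⟨by linarith, by linarith⟩
      ⟨by linarith, by linarith⟩
  -- For `Y₀` the observed arm is `X = 0`, whose propensity lies in `[1 - h, 1 - l]`.
  · have := cdf_bounds_of_propensity_bounds (p := 1 - p) (l := 1 - h) (h := 1 - l) (F := F₀)
      (G := G₀ * p + F₀ * (1 - p)) (by linarith) (by linarith) ⟨by linarith, by linarith⟩
      ⟨by linarith, by linarith⟩
    rwa [show 1 - h - (1 - p) = p - h by ring, show 1 - l - (1 - p) = p - l by ring] at this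

/-! ### Attainment through a latent binary state -/

/-- Conditional weights of the low state of a latent binary variable with `P(X = 1) = l` in the
low state, `P(X = 1) = h` in the high state and `P(X = 1) = p` overall. -/
lemma latent_state_weights {p l h : ℝ} (hl : 0 < l) (hlp : l ≤ p) (hph : p ≤ h) (hh : h < 1) :
    ∃ δ ∈ Icc (0 : ℝ) 1, δ = (p - l) / (h - l) ∧
      l * (1 - δ) / p ∈ Icc (0 : ℝ) 1 ∧ (1 - l) * (1 - δ) / (1 - p) ∈ Icc (0 : ℝ) 1 ∧
      p * (l * (1 - δ) / p) = l * (1 - δ) ∧ p * (1 - l * (1 - δ) / p) = h * δ ∧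
      (1 - p) * ((1 - l) * (1 - δ) / (1 - p)) = (1 - l) * (1 - δ) ∧
      (1 - p) * (1 - (1 - l) * (1 - δ) / (1 - p)) = (1 - h) * δ := by
  have hp : 0 < p := by linarith
  have hq : 0 < 1 - p := by linarith
  obtain ⟨δ, hδ⟩ : ∃ δ, δ = (p - l) / (h - l) := ⟨_, rfl⟩
  have hd : δ ∈ Icc (0 : ℝ) 1 :=
    hδ ▸ ⟨div_nonneg (by linarith) (by linarith), div_le_one_of_le₀ (by linarith) (by linarith)⟩
  have hmix : h * δ + l * (1 - δ) = p := by
    -- If `h = l` then `p = l`, and the identity holds for every `δ`.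
    by_cases e : h = l
    · have : p = l := by linarith
      subst e this; ring
    · have : h - l ≠ 0 := sub_ne_zero.2 e
      rw [hδ]; field_simp; ring
  have n1 : 0 ≤ h * δ := mul_nonneg (by linarith) hd.1
  have n2 : 0 ≤ l * (1 - δ) := mul_nonneg hl.le (sub_nonneg.2 hd.2)
  have n3 : 0 ≤ (1 - h) * δ := mul_nonneg (by linarith) hd.1
  have n4 : 0 ≤ (1 - l) * (1 - δ) := mul_nonneg (by linarith) (sub_nonneg.2 hd.2)
  refine ⟨δ, hd, hδ, ⟨div_nonneg n2 hp.le, div_le_one_of_le₀ (by linarith) hp.le⟩,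
    ⟨div_nonneg n4 hq.le, div_le_one_of_le₀ (by linarith) hq.le⟩, ?_, ?_, ?_, ?_⟩
  · field_simp
  · rw [mul_sub, mul_div_cancel₀ _ hp.ne']; linarith
  · field_simp
  · rw [mul_sub, mul_div_cancel₀ _ hq.ne']; linarith

/-- Clipping to the unit interval. -/
noncomputable def clip (x : ℝ) : ℝ := max 0 (min 1 x)

lemma clip_mem (x : ℝ) : clip x ∈ Icc (0 : ℝ) 1 :=
  ⟨le_max_left _ _, max_le zero_le_one (min_le_left _ _)⟩

lemma clip_of_mem {x : ℝ} (hx : x ∈ Icc (0 : ℝ) 1) : clip x = x := by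
  rw [clip, min_eq_right hx.2, max_eq_right hx.1]

/-- By Bayes' rule, `lam` and `mu` are the probabilities of the low state given `X = 1` and `X = 0`,
and `δ` is that of the high state. Clipping keeps the weights in the unit interval off the support,
where the bounds are unconstrained. -/
lemma exists_latent_state_weights (hcLo : Measurable cLo) (hcHi : Measurable cHi)
    (hc : AdmissibleBounds κ P cLo cHi) :
    ∃ lam mu δ : Cov d → ℝ, Measurable lam ∧ Measurable mu ∧ (∀ w, lam w ∈ Icc (0 : ℝ) 1) ∧
      (∀ w, mu w ∈ Icc (0 : ℝ) 1) ∧ ∀ w ∈ suppW P, δ w ∈ Icc (0 : ℝ) 1 ∧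
        prop κ true w * lam w = cLo w * (1 - δ w) ∧
        prop κ true w * (1 - lam w) = cHi w * δ w ∧
        prop κ false w * mu w = (1 - cLo w) * (1 - δ w) ∧
        prop κ false w * (1 - mu w) = (1 - cHi w) * δ w := by
  have hp := measurable_prop κ true
  let δ : Cov d → ℝ := fun w => (prop κ true w - cLo w) / (cHi w - cLo w)
  have hδ : Measurable δ := by fun_prop
  refine ⟨fun w => clip (cLo w * (1 - δ w) / prop κ true w),
    fun w => clip ((1 - cLo w) * (1 - δ w) / (1 - prop κ true w)), δ, ?_, ?_,
    fun w => clip_mem _, fun w => clip_mem _, fun w hw => ?_⟩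
  · unfold clip; fun_prop
  · unfold clip; fun_prop
  · obtain ⟨h1, h2, h3, h4⟩ := hc w hw
    obtain ⟨e, he, hee, k1, k2, k3, k4, k5, k6⟩ := latent_state_weights h1 h2 h3 h4
    have hq : prop κ false w = 1 - prop κ true w := by
      linarith [prop_true_add_prop_false κ w]
    beta_reduce
    rw [show δ w = e from hee.symm, clip_of_mem k1, clip_of_mem k2, hq]
    exact ⟨he, k3, k4, k5, k6⟩

/-- Conditional law of `(Y₁, Y₀)` given `(X, W)` when `Y₁` and `Y₀` are independent in each state
of a latent binary variable, whose low state has probability `l (x, w)`. -/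
lemma exists_latentState_kernel (A A' B B' : Kernel (Cov d) ℝ) [IsMarkovKernel A]
    [IsMarkovKernel A'] [IsMarkovKernel B] [IsMarkovKernel B'] {lam mu : Cov d → ℝ}
    (hlam : Measurable lam) (hmu : Measurable mu) (hl : ∀ w, lam w ∈ Icc (0 : ℝ) 1)
    (hm : ∀ w, mu w ∈ Icc (0 : ℝ) 1) :
    ∃ ν : Kernel (Bool × Cov d) (ℝ × ℝ), IsMarkovKernel ν ∧ ∀ x w (S : Set (ℝ × ℝ)),
      (ν (x, w)).real S = (bif x then lam w else mu w) * ((A w).prod (B w)).real S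
        + (1 - (bif x then lam w else mu w)) * ((A' w).prod (B' w)).real S := by
  have hmeas : Measurable fun q : Bool × Cov d => bif q.1 then lam q.2 else mu q.2 :=
    measurable_from_prod_countable_right fun x => by cases x <;> simpa
  obtain ⟨ν, hν, h⟩ := exists_mixture_kernel (Kernel.prodMkLeft Bool (A ×ₖ B))
    (Kernel.prodMkLeft Bool (A' ×ₖ B')) hmeas (fun q => by
      rcases q with ⟨_ | _, w⟩
      · exact hm w
      · exact hl w)
  refine ⟨ν, hν, fun x w S => ?_⟩
  rw [h]
  simp only [Kernel.prodMkLeft_apply, Kernel.prod_apply]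

/-- Every pair of convex combinations of the cdf bounds is attained under joint `c`-dependence. -/
lemma exists_mem_identifiedSet₀_joint (hcLo : Measurable cLo) (hcHi : Measurable cHi)
    (hc : AdmissibleBounds κ P cLo cHi) {e g : ℝ} (he : e ∈ Icc (0 : ℝ) 1)
    (hg : g ∈ Icc (0 : ℝ) 1) :
    ∃ C, (e • lowerF1 κ P cLo cHi + (1 - e) • upperF1 κ P cLo cHi,
      g • lowerF0 κ P cLo cHi + (1 - g) • upperF0 κ P cLo cHi, C)
        ∈ identifiedSet₀ κ P cLo cHi .joint := by
  obtain ⟨lam, mu, δ, hlamM, hmuM, hlam, hmu, hw⟩ := exists_latent_state_weights hcLo hcHi hc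
  obtain ⟨M₁, hM₁, hobs₁⟩ := exists_obsKernel κ true
  obtain ⟨M₀, hM₀, hobs₀⟩ := exists_obsKernel κ false
  have hlam' : ∀ w, 1 - lam w ∈ Icc (0 : ℝ) 1 := fun w => Icc.mem_iff_one_sub_mem.1 (hlam w)
  have hmu' : ∀ w, 1 - mu w ∈ Icc (0 : ℝ) 1 := fun w => Icc.mem_iff_one_sub_mem.1 (hmu w)
  have he' := Icc.mem_iff_one_sub_mem.1 he
  have hg' := Icc.mem_iff_one_sub_mem.1 hg
  have hmeas : ∀ {l : Cov d → ℝ} (c : ℝ), Measurable l →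
      Measurable fun q : Cov d × ℝ => tailMix (l q.1) c q.2 := fun c hl =>
    (measurable_tailMix c).comp ((hl.comp measurable_fst).prodMk measurable_snd)
  have dA := fun w => isDistortion_tailMix (hlam w) he
  have dA' := fun w => isDistortion_tailMix (hlam' w) he'
  -- The weight is `1 - g` in the low state because `X = 0` is rarest in the high state, so for `Y₀`
  -- the roles of the states are exchanged.
  have dB := fun w => isDistortion_tailMix (hmu w) hg'
  have dB' := fun w => isDistortion_tailMix (hmu' w) hg
  obtain ⟨A, _, hA⟩ := exists_distorted_kernel M₁ dA (hmeas _ hlamM)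
  obtain ⟨A', _, hA'⟩ := exists_distorted_kernel M₁ dA' (hmeas _ (hlamM.const_sub 1))
  obtain ⟨B, _, hB⟩ := exists_distorted_kernel M₀ dB (hmeas _ hmuM)
  obtain ⟨B', _, hB'⟩ := exists_distorted_kernel M₀ dB' (hmeas _ (hmuM.const_sub 1))
  obtain ⟨ν, hν, hνS⟩ := exists_latentState_kernel A A' B B' hlamM hmuM hlam hmu
  have s1 : ∀ y : ℝ, {z : ℝ × ℝ | z.1 ≤ y} = Iic y ×ˢ univ := fun y => by ext; simp
  have s0 : ∀ y : ℝ, {z : ℝ × ℝ | z.2 ≤ y} = univ ×ˢ Iic y := fun y => by ext; simp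
  have s10 : ∀ y y' : ℝ, {z : ℝ × ℝ | z.1 ≤ y ∧ z.2 ≤ y'} = Iic y ×ˢ Iic y' :=
    fun y y' => by ext; simp [Prod.le_def]
  have m1 : ∀ x w y, (ν (x, w)).real {z | z.1 ≤ y}
      = (bif x then lam w else mu w) * tailMix (lam w) e ((M₁ w).real (Iic y))
        + (1 - (bif x then lam w else mu w))
          * tailMix (1 - lam w) (1 - e) ((M₁ w).real (Iic y)) := fun x w y => by
    rw [hνS, s1, measureReal_prod_prod, measureReal_prod_prod, hA, hA']
    simp
  have m0 : ∀ x w y, (ν (x, w)).real {z | z.2 ≤ y}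
      = (bif x then lam w else mu w) * tailMix (mu w) (1 - g) ((M₀ w).real (Iic y))
        + (1 - (bif x then lam w else mu w))
          * tailMix (1 - mu w) g ((M₀ w).real (Iic y)) := fun x w y => by
    rw [hνS, s0, measureReal_prod_prod, measureReal_prod_prod, hB, hB']
    simp
  have m10 : ∀ x w y y', (ν (x, w)).real {z | z.1 ≤ y ∧ z.2 ≤ y'}
      = (bif x then lam w else mu w) * (tailMix (lam w) e ((M₁ w).real (Iic y))
          * tailMix (mu w) (1 - g) ((M₀ w).real (Iic y')))
        + (1 - (bif x then lam w else mu w))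
          * (tailMix (1 - lam w) (1 - e) ((M₁ w).real (Iic y))
            * tailMix (1 - mu w) g ((M₀ w).real (Iic y'))) := fun x w y y' => by
    rw [hνS, s10, measureReal_prod_prod, measureReal_prod_prod, hA, hA', hB, hB']
  have dec1 : ∀ w, ∀ u ∈ Icc (0 : ℝ) 1,
      lam w * tailMix (lam w) e u + (1 - lam w) * tailMix (1 - lam w) (1 - e) u = u :=
    fun w u hu => tailMix_decomposition (hlam w) hu
  have dec0 : ∀ w, ∀ u ∈ Icc (0 : ℝ) 1,
      mu w * tailMix (mu w) (1 - g) u + (1 - mu w) * tailMix (1 - mu w) g u = u :=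
    fun w u hu => by
      have := tailMix_decomposition (e := 1 - g) (hmu w) hu
      rwa [sub_sub_cancel] at this
  have hcop : ∀ (x : Bool) (w : suppW P), ∃ C : ℝ → ℝ → ℝ, IsCopula C ∧ ∀ y₁ y₀,
      (ν (x, (w : Cov d))).real {z | z.1 ≤ y₁ ∧ z.2 ≤ y₀}
        = C ((ν (x, (w : Cov d))).real {z | z.1 ≤ y₁})
            ((ν (x, (w : Cov d))).real {z | z.2 ≤ y₀}) := by
    rintro x ⟨w, hwP⟩
    obtain ⟨hl, hlp, hph, hh⟩ := hc w hwP
    obtain ⟨-, r1, r2, r3, r4⟩ := hw w hwP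
    have hq := prop_true_add_prop_false κ w
    have hp0 : 0 < prop κ true w := by linarith
    have hq0 : 0 < prop κ false w := by linarith
    have hl1 : 0 < 1 - cLo w := by linarith
    have hh0 : 0 < cHi w := by linarith
    have hh1 : 0 < 1 - cHi w := by linarith
    have hmono : StrictMonoOn (fun u => (bif x then lam w else mu w) * tailMix (lam w) e u
          + (1 - (bif x then lam w else mu w)) * tailMix (1 - lam w) (1 - e) u) (Icc 0 1) ∧
        StrictMonoOn (fun u => (bif x then lam w else mu w) * tailMix (mu w) (1 - g) u
          + (1 - (bif x then lam w else mu w)) * tailMix (1 - mu w) g u) (Icc 0 1) := by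
      -- In the observed arm the mixture is the identity, so both factors are `1`. In the other arm
      -- the state weights change by the odds ratios that Bayes' rule gives, which are positive.
      cases x
      · refine ⟨strictMonoOn_reweighted (dA w).monotone (dA' w).monotone (hlam w) (dec1 w)
          (s := (1 - cLo w) * prop κ true w / (cLo w * prop κ false w))
          (t := (1 - cHi w) * prop κ true w / (cHi w * prop κ false w))
          (by positivity) (by positivity) ?_ ?_,
          strictMonoOn_reweighted (dB w).monotone (dB' w).monotone (hmu w) (dec0 w)
          one_pos one_pos (by simp) (by simp)⟩
        · simp only [cond_false]
          rw [div_mul_eq_mul_div, eq_div_iff (by positivity)]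
          linear_combination cLo w * r3 - (1 - cLo w) * r1
        · simp only [cond_false]
          rw [div_mul_eq_mul_div, eq_div_iff (by positivity)]
          linear_combination cHi w * r4 - (1 - cHi w) * r2
      · refine ⟨strictMonoOn_reweighted (dA w).monotone (dA' w).monotone (hlam w) (dec1 w)
          one_pos one_pos (by simp) (by simp),
          strictMonoOn_reweighted (dB w).monotone (dB' w).monotone (hmu w) (dec0 w)
          (s := cLo w * prop κ false w / ((1 - cLo w) * prop κ true w))
          (t := cHi w * prop κ false w / ((1 - cHi w) * prop κ true w))
          (by positivity) (by positivity) ?_ ?_⟩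
        · simp only [cond_true]
          rw [div_mul_eq_mul_div, eq_div_iff (by positivity)]
          linear_combination (1 - cLo w) * r1 - cLo w * r3
        · simp only [cond_true]
          rw [div_mul_eq_mul_div, eq_div_iff (by positivity)]
          linear_combination (1 - cHi w) * r2 - cHi w * r4
    obtain ⟨C, hC, hCe⟩ := exists_copula_of_mixture (dA w) (dA' w) (dB w) (dB' w)
      (l := bif x then lam w else mu w) (by cases x; exacts [hmu w, hlam w]) hmono.1 hmono.2
    refine ⟨C, hC, fun y₁ y₀ => ?_⟩
    rw [m1, m0, m10, hCe _ (real_Iic_mem_Icc _ _) _ (real_Iic_mem_Icc _ _)]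
  choose C hC hCe using hcop
  have obs1 : ∀ (w : suppW P) y, (M₁ w).real (Iic y) = obsCDF κ true w y := fun w y =>
    hobs₁ w (by have := hc w w.2; exact ne_of_gt (by linarith)) y
  have obs0 : ∀ (w : suppW P) y, (M₀ w).real (Iic y) = obsCDF κ false w y := fun w y =>
    hobs₀ w (by
      have := hc w w.2
      have := prop_true_add_prop_false κ (w : Cov d)
      exact ne_of_gt (by linarith)) y
  refine ⟨C, (fun x w y => (ν (x, (w : Cov d))).real {z | z.1 ≤ y},
    fun x w y => (ν (x, (w : Cov d))).real {z | z.2 ≤ y}, C),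
    ⟨ν, hν, fun _ _ _ => rfl, fun _ _ _ => rfl, hC, hCe, ?_, ?_, ?_⟩, ?_⟩
  · intro w y
    simp only [m1, cond_true]
    rw [dec1 _ _ (real_Iic_mem_Icc _ _), obs1]
  · intro w y
    simp only [m0, cond_false]
    rw [dec0 _ _ (real_Iic_mem_Icc _ _), obs0]
  · simp only [SatisfiesCDep]
    intro w hwP
    refine (latentPropensity_mem_Icc_iff κ ν w (T := fun z => z) measurable_id (cLo w)
      (cHi w)).2 fun S _ => ?_
    obtain ⟨hd, r1, r2, r3, r4⟩ := hw w hwP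
    obtain ⟨hl, hlp, hph, hh⟩ := hc w hwP
    simp only [hνS, cond_true, cond_false, preimage_id']
    have n1 := mul_nonneg (sub_nonneg.2 hd.2) (measureReal_nonneg (μ := (A w).prod (B w)) (s := S))
    have n2 := mul_nonneg hd.1 (measureReal_nonneg (μ := (A' w).prod (B' w)) (s := S))
    generalize ((A w).prod (B w)).real S = a at *
    generalize ((A' w).prod (B' w)).real S = b at *
    -- Together with `q0`, this exhibits the propensity on `S` as an average of `cLo w` and `cHi w`
    -- with weights `(1 - δ w) * a` and `δ w * b`.
    have q1 : prop κ true w * (lam w * a + (1 - lam w) * b)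
        = cLo w * ((1 - δ w) * a) + cHi w * (δ w * b) := by
      linear_combination a * r1 + b * r2
    have q0 : prop κ false w * (mu w * a + (1 - mu w) * b)
        = (1 - cLo w) * ((1 - δ w) * a) + (1 - cHi w) * (δ w * b) := by
      linear_combination a * r3 + b * r4
    rw [q1, q0]
    have := mul_nonneg (sub_nonneg.2 (hlp.trans hph)) n1
    have := mul_nonneg (sub_nonneg.2 (hlp.trans hph)) n2
    constructor <;> linarith
  · refine Prod.ext ?_ (Prod.ext ?_ rfl)
    · funext w y
      obtain ⟨-, r1, r2, r3, r4⟩ := hw w w.2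
      obtain ⟨hl, hlp, hph, hh⟩ := hc w w.2
      have hh0 : 0 < cHi w := by linarith
      have hu := real_Iic_mem_Icc (M₁ w) y
      -- The densities `p / cLo` and `p / cHi` turn the state weights given `X = 1` into the
      -- unconditional ones.
      have key := tailMix_reweighted (e := e) (hlam w) hu
        (div_le_div_of_nonneg_left (by linarith : 0 ≤ prop κ true w) hl (hlp.trans hph))
        (by
          rw [← mul_div_assoc, ← mul_div_assoc, mul_comm (lam _), r1,
            mul_comm (1 - lam _), r2, mul_div_cancel_left₀ _ hl.ne', mul_div_cancel_left₀ _ hh0.ne',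
            sub_add_cancel])
      simp only [averageX, m1, cond_true, cond_false, Pi.add_apply, Pi.smul_apply, smul_eq_mul,
        lowerF1, upperF1, sub_div, div_self hl.ne', div_self hh0.ne']
      rw [← obs1, ← key]
      generalize tailMix (lam w) e _ = a
      generalize tailMix (1 - lam w) (1 - e) _ = b
      have q1 : prop κ true w / cLo w * (lam w * a) = (1 - δ w) * a := by
        rw [div_mul_eq_mul_div, div_eq_iff hl.ne']
        linear_combination a * r1
      have q2 : prop κ true w / cHi w * ((1 - lam w) * b) = δ w * b := by
        rw [div_mul_eq_mul_div, div_eq_iff hh0.ne']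
        linear_combination b * r2
      rw [q1, q2]
      linear_combination a * (r1 + r3) + b * (r2 + r4)
    · funext w y
      obtain ⟨-, r1, r2, r3, r4⟩ := hw w w.2
      obtain ⟨hl, hlp, hph, hh⟩ := hc w w.2
      have hq : prop κ false (w : Cov d) = 1 - prop κ true (w : Cov d) := by
        linarith [prop_true_add_prop_false κ (w : Cov d)]
      have hl1 : 0 < 1 - cLo w := by linarith
      have hh1 : 0 < 1 - cHi w := by linarith
      have hu := real_Iic_mem_Icc (M₀ w) y
      -- Here the high state carries the larger density, so `1 - mu` takes the place of `lam`.
      have key := tailMix_reweighted (e := g) (hmu' w) hu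
        (div_le_div_of_nonneg_left (by linarith : 0 ≤ prop κ false w) hh1
          (by linarith : 1 - cHi w ≤ 1 - cLo w))
        (by
          rw [sub_sub_cancel, ← mul_div_assoc, ← mul_div_assoc, mul_comm (1 - mu _), r4,
            mul_comm (mu _), r3, mul_div_cancel_left₀ _ hl1.ne', mul_div_cancel_left₀ _ hh1.ne',
            add_sub_cancel])
      have e1 : (prop κ true w - cHi w) / (1 - cHi w) = 1 - prop κ false w / (1 - cHi w) := by
        rw [hq]; field_simp; ring
      have e2 : (prop κ true w - cLo w) / (1 - cLo w) = 1 - prop κ false w / (1 - cLo w) := by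
        rw [hq]; field_simp; ring
      simp only [averageX, m0, cond_true, cond_false, Pi.add_apply, Pi.smul_apply, smul_eq_mul,
        lowerF0, upperF0, e1, e2]
      rw [← obs0, ← key, sub_sub_cancel]
      generalize tailMix (mu w) (1 - g) _ = a
      generalize tailMix (1 - mu w) g _ = b
      have q1 : prop κ false w / (1 - cLo w) * (mu w * a) = (1 - δ w) * a := by
        rw [div_mul_eq_mul_div, div_eq_iff hl1.ne']
        linear_combination a * r3
      have q2 : prop κ false w / (1 - cHi w) * ((1 - mu w) * b) = δ w * b := by
        rw [div_mul_eq_mul_div, div_eq_iff hh1.ne']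
        linear_combination b * r4
      rw [q1, q2]
      linear_combination a * (r1 + r3) + b * (r2 + r4)

lemma exists_mem_identifiedSet₀ (hcLo : Measurable cLo) (hcHi : Measurable cHi)
    (hc : AdmissibleBounds κ P cLo cHi) (i : Model) {e g : ℝ} (he : e ∈ Icc (0 : ℝ) 1)
    (hg : g ∈ Icc (0 : ℝ) 1) :
    ∃ C, (e • lowerF1 κ P cLo cHi + (1 - e) • upperF1 κ P cLo cHi,
      g • lowerF0 κ P cLo cHi + (1 - g) • upperF0 κ P cLo cHi, C)
        ∈ identifiedSet₀ κ P cLo cHi i := by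
  obtain ⟨C, T, ⟨ν, hν, h1, h2, h3, h4, h5, h6, h7⟩, hT⟩ :=
    exists_mem_identifiedSet₀_joint hcLo hcHi hc he hg
  refine ⟨C, T, ⟨ν, hν, h1, h2, h3, h4, h5, h6, ?_⟩, hT⟩
  cases i
  · exact satisfiesCDep_marg_of_joint κ P cLo cHi ν h7
  · exact h7

end

end CDependence

/-! ### From the cdf bounds to the parameter -/

/-- `P` is the law of `(W, X, Y)`, `κ` any regular conditional law of `(X, Y)` given `W`; the
parameter `θ` only has to be monotone on a domain `D₁ × D₀` containing the pairs of conditional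
cdfs that occur in the identified set. -/
theorem mainTheorem3 {d : ℕ}
    (P : Measure (Cov d × Bool × ℝ)) [IsProbabilityMeasure P]
    (κ : Kernel (Cov d) (Bool × ℝ)) [IsMarkovKernel κ] (hκ : P.IsCondKernel κ)
    (hoverlap : Overlap κ P)
    (cLo cHi : Cov d → ℝ) (hcLo : Measurable cLo) (hcHi : Measurable cHi)
    (hc : AdmissibleBounds κ P cLo cHi)
    (i : Model)
    (θ : (P : Measure (Cov d × Bool × ℝ)) → CondFun P → CondFun P → ℝ)
    (D₁ D₀ : Set (CondFun P))
    (hD : ∀ t ∈ identifiedSet₀ κ P cLo cHi i, t.1 ∈ D₁ ∧ t.2.1 ∈ D₀)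
    (hθ : IncreasingDecreasingOn D₁ D₀ (θ P)) :
    let Fl₁ := lowerF1 κ P cLo cHi
    let Fu₁ := upperF1 κ P cLo cHi
    let Fl₀ := lowerF0 κ P cLo cHi
    let Fu₀ := upperF0 κ P cLo cHi
    let I := paramIdentifiedSet κ P cLo cHi i
      (fun F₁ F₀ => θ P (averageX κ P F₁) (averageX κ P F₀))
    let V := (fun t => θ P t.1 t.2.1) '' identifiedSet₀ κ P cLo cHi i
    (IsGLB V (θ P Fu₁ Fl₀) ∧ IsLUB V (θ P Fl₁ Fu₀) ∧
      convexHull ℝ I = Icc (sInf V) (sSup V) ∧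
      convexHull ℝ I = Icc (θ P Fu₁ Fl₀) (θ P Fl₁ Fu₀)) ∧
    (ContinuousOn
        (fun e : ℝ × ℝ =>
          θ P (e.1 • Fl₁ + (1 - e.1) • Fu₁) (e.2 • Fl₀ + (1 - e.2) • Fu₀))
        (Icc (0 : ℝ) 1 ×ˢ Icc (0 : ℝ) 1) →
      I = Icc (θ P Fu₁ Fl₀) (θ P Fl₁ Fu₀)) := by
  intro Fl₁ Fu₁ Fl₀ Fu₀ I V
  have hIV : I = V := by
    ext r
    constructor
    · rintro ⟨F₁, F₀, C, h, rfl⟩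
      exact ⟨_, ⟨_, h, rfl⟩, rfl⟩
    · rintro ⟨_, ⟨⟨F₁, F₀, C⟩, h, rfl⟩, rfl⟩
      exact ⟨F₁, F₀, C, h, rfl⟩
  let Θ : ℝ × ℝ → ℝ := fun e => θ P (e.1 • Fl₁ + (1 - e.1) • Fu₁) (e.2 • Fl₀ + (1 - e.2) • Fu₀)
  have hmem : ∀ e ∈ Icc (0 : ℝ) 1 ×ˢ Icc (0 : ℝ) 1, Θ e ∈ V := by
    rintro ⟨e, g⟩ ⟨he, hg⟩
    obtain ⟨C, hC⟩ := exists_mem_identifiedSet₀ hcLo hcHi hc i he hg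
    exact ⟨_, hC, rfl⟩
  have h01 : Θ (0, 1) = θ P Fu₁ Fl₀ := by simp [Θ]
  have h10 : Θ (1, 0) = θ P Fl₁ Fu₀ := by simp [Θ]
  have hlow : ∃ C, (Fu₁, Fl₀, C) ∈ identifiedSet₀ κ P cLo cHi i := by
    simpa using exists_mem_identifiedSet₀ hcLo hcHi hc i (e := 0) (g := 1) (by simp) (by simp)
  have hupp : ∃ C, (Fl₁, Fu₀, C) ∈ identifiedSet₀ κ P cLo cHi i := by
    simpa using exists_mem_identifiedSet₀ hcLo hcHi hc i (e := 1) (g := 0) (by simp) (by simp)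
  obtain ⟨Cl, hCl⟩ := hlow
  obtain ⟨Cu, hCu⟩ := hupp
  have hleast : IsLeast V (θ P Fu₁ Fl₀) := by
    refine ⟨⟨_, hCl, rfl⟩, ?_⟩
    rintro _ ⟨t, ht, rfl⟩
    have hb := bounds_of_mem_identifiedSet₀ hc ht
    -- The intermediate pair `(t.1, Fl₀)` need not come from the identified set; it lies in the
    -- product `D₁ × D₀`.
    exact (hθ.1 _ (hD _ hCl).2 _ (hD _ ht).1 _ (hD _ hCl).1 fun w y => (hb w y).1.2).trans
      (hθ.2 _ (hD _ ht).1 _ (hD _ hCl).2 _ (hD _ ht).2 fun w y => (hb w y).2.1)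
  have hgreatest : IsGreatest V (θ P Fl₁ Fu₀) := by
    refine ⟨⟨_, hCu, rfl⟩, ?_⟩
    rintro _ ⟨t, ht, rfl⟩
    have hb := bounds_of_mem_identifiedSet₀ hc ht
    exact (hθ.1 _ (hD _ ht).2 _ (hD _ hCu).1 _ (hD _ ht).1 fun w y => (hb w y).1.1).trans
      (hθ.2 _ (hD _ hCu).1 _ (hD _ ht).2 _ (hD _ hCu).2 fun w y => (hb w y).2.2)
  have hsub : V ⊆ Icc (θ P Fu₁ Fl₀) (θ P Fl₁ Fu₀) := fun r hr => ⟨hleast.2 hr, hgreatest.2 hr⟩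
  have hhull : convexHull ℝ I = Icc (θ P Fu₁ Fl₀) (θ P Fl₁ Fu₀) := by
    rw [hIV]
    refine (convexHull_min hsub (convex_Icc _ _)).antisymm ?_
    exact (convex_convexHull ℝ V).ordConnected.out (subset_convexHull ℝ V hleast.1)
      (subset_convexHull ℝ V hgreatest.1)
  refine ⟨⟨hleast.isGLB, hgreatest.isLUB, ?_, hhull⟩, fun hcont => ?_⟩
  · rw [hleast.isGLB.csInf_eq ⟨_, hleast.1⟩, hgreatest.isLUB.csSup_eq ⟨_, hleast.1⟩, hhull]
  · rw [hIV]
    refine hsub.antisymm ?_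
    have hconn : IsPreconnected (Θ '' (Icc (0 : ℝ) 1 ×ˢ Icc (0 : ℝ) 1)) :=
      (isPreconnected_Icc.prod isPreconnected_Icc).image Θ hcont
    have hicc := hconn.Icc_subset ⟨(0, 1), by simp, h01⟩ ⟨(1, 0), by simp, h10⟩
    refine hicc.trans ?_
    rintro _ ⟨e, he, rfl⟩
    exact hmem e he
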